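/- All languages are relational. Let $\mathbf{K}$ be a Fraïssé structure in a language $L$, i.e. a countable $L$-structure such that every embedding of a finite substructure of $\mathbf{K}$ into $\mathbf{K}$ extends to an automorphism. Let $\mathrm{Emb}(\mathbf{A},\mathbf{K})$ be the set of embeddings of $\mathbf{A}$ into $\mathbf{K}$, let $\mathrm{Emb}(\mathbf{K})=\mathrm{Emb}(\mathbf{K},\mathbf{K})$, and let $\mathrm{Age}(\mathbf{K})$ be the class of finite structures which embed into $\mathbf{K}$. A structure $\mathbf{A}\in \mathrm{Age}(\mathbf{K})$ has big Ramsey degree $\ell<\omega$ if $\ell$ is least such that for every $r>\ell$ and every $\gamma:\mathrm{Emb}(\mathbf{A},\mathbf{K})\to r$ there is $\eta\in\mathrm{Emb}(\mathbf{K})$ with $|\{\gamma(\eta\circ f): f\in\mathrm{Emb}(\mathbf{A},\mathbf{K})\}|\le \ell$. For an injection $f:A\to K$ and a structure $x$ on $K$, $x\cdot f$ denotes the structure on $A$ which makes $f:x\cdot f\to x$ an embedding. A *big Ramsey structure* for $\mathbf{K}$ is an expansion $\mathbf{K}'$ of $\mathbf{K}$ to a language $L'\supseteq L$ such that for every $\mathbf{A}\in\mathrm{Age}(\mathbf{K})$: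 the set $\mathbf{K}'(\mathbf{A})$ of $L'$-expansions of $\mathbf{A}$ which embed into $\mathbf{K}'$ is finite; $\mathbf{A}$ has big Ramsey degree $|\mathbf{K}'(\mathbf{A})|$; and the coloring $f\mapsto \mathbf{K}'\cdot f$ of $\mathrm{Emb}(\mathbf{A},\mathbf{K})$ witnesses that the big Ramsey degree is not smaller, i.e. $|\{\mathbf{K}'\cdot(\eta\circ f): f\in\mathrm{Emb}(\mathbf{A},\mathbf{K})\}|\ge|\mathbf{K}'(\mathbf{A})|$ for every $\eta\in \mathrm{Emb}(\mathbf{K})$. For a Hausdorff topological group $G$, a *$G$-flow* is a compact Hausdorff space $X$ with a continuous right action $X\times G\to X$; a *$G$-map* is a continuous $G$-equivariant map, and an isomorphism of flows is an equivariant homeomorphism. Let $\widehat G$ be the left completion of $G$, i.e. its completion with respect to the left uniformity; on every flow $X$ each orbit map $g\mapsto xg$ extends uniquely to a continuous map $\eta\mapsto x\eta$ on $\widehat G$. A point $x\in X$ is a *completion point* if $x\eta$ has dense $G$-orbit for every $\eta\in\widehat G$; a *completion flow* is a flow containing a completion point; a completion flow $X$ is *universal* if for every completion flow $Y$ there is a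 surjective $G$-map $X\to Y$. Let $G=\mathrm{Aut}(\mathbf{K})$ with the topology of pointwise convergence ($K$ discrete). $G$ acts on the right on the space of $L'$-structures on the set $K$ by $x\mapsto x\cdot g$; this space carries the logic topology, generated by the sets $\{x: x\cdot f=\mathbf{A}\}$ for finite $L'$-structures $\mathbf{A}$ and injections $f:A\to K$. For a big Ramsey structure $\mathbf{K}'$ let $X_{\mathbf{K}'}=\overline{\mathbf{K}'\cdot G}$. A *big Ramsey flow* is a flow isomorphic to some such $X_{\mathbf{K}'}$. **Theorem.** Let $\mathbf{K}$ be a Fraïssé structure which admits a big Ramsey structure, and let $G=\mathrm{Aut}(\mathbf{K})$. Then for every big Ramsey structure $\mathbf{K}'$ the space $X_{\mathbf{K}'}$ with the restricted action is a universal completion flow of $G$; any big Ramsey flow is a universal completion flow of $G$; and any two universal completion flows of $G$ are isomorphic. -/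

import Mathlib

open Set Filter Topology MulOpposite
open scoped FirstOrder

universe u v w w₁ w₂ a b c d

noncomputable section

namespace BigRamsey

/-! ### Topological dynamics

Right actions of `G` are written as left actions of `Gᵐᵒᵖ`, so that `x · g` is `op g • x`. -/

section Dynamics

variable (G : Type*) [Group G] [TopologicalSpace G]

/-- A (right) `G`-flow: a compact Hausdorff space with a (jointly) continuous right action. -/
structure IsFlow (X : Type*) [TopologicalSpace X] [MulAction Gᵐᵒᵖ X] : Prop where
  compact : CompactSpace X
  hausdorff : T2Space X
  continuous_act : Continuous fun p : X × G => op p.2 • p.1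

/-- `φ` is a `G`-map (map of flows). -/
structure IsFlowMap {X Y : Type*} [TopologicalSpace X] [TopologicalSpace Y]
    [MulAction Gᵐᵒᵖ X] [MulAction Gᵐᵒᵖ Y] (φ : X → Y) : Prop where
  continuous : Continuous φ
  map_act : ∀ (x : X) (g : G), φ (op g • x) = op g • φ x

/-- Two flows are isomorphic: there is an equivariant homeomorphism. -/
def FlowIso (X Y : Type*) [TopologicalSpace X] [TopologicalSpace Y]
    [MulAction Gᵐᵒᵖ X] [MulAction Gᵐᵒᵖ Y] : Prop :=
  ∃ e : X ≃ₜ Y, IsFlowMap G e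

/-- The ambits `(X, x₀)` and `(Y, y₀)` are isomorphic: there is an equivariant homeomorphism
which sends `x₀` to `y₀`. -/
def AmbitIso {X Y : Type*} [TopologicalSpace X] [TopologicalSpace Y]
    [MulAction Gᵐᵒᵖ X] [MulAction Gᵐᵒᵖ Y] (x₀ : X) (y₀ : Y) : Prop :=
  ∃ e : X ≃ₜ Y, IsFlowMap G e ∧ e x₀ = y₀

/-- `x` has dense orbit in `X`. -/
def HasDenseOrbit {X : Type*} [TopologicalSpace X] [MulAction Gᵐᵒᵖ X] (x : X) : Prop :=
  Dense (range fun g : G => op g • x)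

variable [IsTopologicalGroup G]

/-- The left completion `Ĝ` of `G`: the completion with respect to the left uniformity, whose
basic entourages are `{(g, h) | g⁻¹ * h ∈ V}` for neighbourhoods `V` of `1`. -/
abbrev LeftCompletion : Type _ :=
  @UniformSpace.Completion G (IsTopologicalGroup.leftUniformSpace G)

/-- The canonical map `G → Ĝ`. -/
def toLeftCompletion (g : G) : LeftCompletion G :=
  @UniformSpace.Completion.coe' G (IsTopologicalGroup.leftUniformSpace G) g

theorem isDenseInducing_toLeftCompletion : IsDenseInducing (toLeftCompletion G) :=
  @UniformSpace.Completion.isDenseInducing_coe G (IsTopologicalGroup.leftUniformSpace G)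

variable {G}

/-- The extended action `x · η` for `η ∈ Ĝ`: the value at `η` of the continuous extension to `Ĝ`
of the orbit map `g ↦ x · g`. (That the extension exists on every flow is
`continuous_completionAct` and `completionAct_coe`.) -/
def completionAct {X : Type*} [TopologicalSpace X] [MulAction Gᵐᵒᵖ X]
    (x : X) (η : LeftCompletion G) : X :=
  (isDenseInducing_toLeftCompletion G).extend (fun g : G => op g • x) η

theorem completionAct_coe {X : Type*} [TopologicalSpace X] [MulAction Gᵐᵒᵖ X]
    (hX : IsFlow G X) (x : X) (g : G) :
    completionAct x (toLeftCompletion G g) = op g • x := by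
  have := hX.hausdorff
  have h : Continuous fun g : G => op g • x :=
    hX.continuous_act.comp (Continuous.prodMk_right x)
  exact (isDenseInducing_toLeftCompletion G).extend_eq h g

theorem continuous_completionAct {X : Type*} [TopologicalSpace X] [MulAction Gᵐᵒᵖ X]
    (hX : IsFlow G X) (x : X) :
    Continuous (completionAct x : LeftCompletion G → X) := by
  have := hX.compact
  have := hX.hausdorff
  let : UniformSpace X := uniformSpaceOfCompactR1
  let := IsTopologicalGroup.leftUniformSpace G
  have huc : UniformContinuous fun g : G => op g • x := by
    intro U hU
    have hcont : Continuous (Function.uncurry fun (g : G) (y : X) => op g • y) :=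
      hX.continuous_act.comp (continuous_snd.prodMk continuous_fst)
    obtain ⟨V, hV, hVU⟩ := isCompact_univ.mem_uniformity_of_prod (s := univ) (q := (1 : G))
      (k := (univ : Set X)) hcont.continuousOn (mem_univ _) (symm_le_uniformity hU)
    rw [nhdsWithin_univ] at hV
    refine ⟨V, hV, ?_⟩
    rintro ⟨g, h⟩ hgh
    have := hVU _ hgh (op g • x) (mem_univ _)
    simpa [smul_smul, ← op_mul] using this
  exact (uniformContinuous_uniformly_extend (UniformSpace.Completion.isUniformInducing_coe G)
    UniformSpace.Completion.denseRange_coe huc).continuous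

variable (G)

/-- `x` is a completion point: `x · η` has dense orbit for every `η ∈ Ĝ`. -/
def IsCompletionPoint {X : Type*} [TopologicalSpace X] [MulAction Gᵐᵒᵖ X] (x : X) : Prop :=
  ∀ η : LeftCompletion G, HasDenseOrbit G (completionAct x η)

/-- A completion flow is a flow which contains a completion point. -/
structure IsCompletionFlow (X : Type*) [TopologicalSpace X] [MulAction Gᵐᵒᵖ X] : Prop where
  isFlow : IsFlow G X
  exists_point : ∃ x : X, IsCompletionPoint G x

/-- A completion flow is universal if it maps onto every completion flow (in the universe `v`) by
a surjective `G`-map. -/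
structure IsUniversalCompletionFlow (X : Type w) [TopologicalSpace X] [MulAction Gᵐᵒᵖ X] :
    Prop where
  isCompletionFlow : IsCompletionFlow G X
  exists_map : ∀ (Y : Type v) [TopologicalSpace Y] [MulAction Gᵐᵒᵖ Y], IsCompletionFlow G Y →
    ∃ φ : X → Y, IsFlowMap G φ ∧ Function.Surjective φ

end Dynamics

/-- The orbit closure `closure (x · G)`, with the restricted action. -/
def orbitClosure (G : Type*) [Group G] {X : Type*} [TopologicalSpace X] [MulAction Gᵐᵒᵖ X]
    [ContinuousConstSMul Gᵐᵒᵖ X] (x : X) : SubMulAction Gᵐᵒᵖ X where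
  carrier := closure (range fun g : G => op g • x)
  smul_mem' := by
    intro c y hy
    refine map_mem_closure (continuous_const_smul c) hy ?_
    rintro _ ⟨g, rfl⟩
    exact ⟨g * c.unop, by simp [mul_smul]⟩

/-! ### Relational structures -/

section Structures

open FirstOrder Language

variable {L : FirstOrder.Language} [L.IsRelational]

/-- For an `L`-structure `B` and an (injective) map `f : A → B`, the structure `B · f` on `A`
which makes `f` an embedding. -/
abbrev pull {A B : Type*} (x : L.Structure B) (f : A → B) : L.Structure A where
  funMap := fun {_} F => isEmptyElim F
  RelMap := fun {_} R a => x.RelMap R (f ∘ a)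

/-- The `L`-reduct of an `L'`-structure along an inclusion of languages. -/
abbrev reduct {L' : FirstOrder.Language} (φ : L →ᴸ L') {A : Type*} (x : L'.Structure A) : L.Structure A :=
  @LHom.reduct L L' φ A x

/-- The logic topology on the space of `L`-structures on the set `K`, generated by the sets
`{x | x · f = A}` with `A` a finite `L`-structure and `f : A → K` an injection. -/
instance logicTopology (K : Type*) : TopologicalSpace (L.Structure K) :=
  TopologicalSpace.generateFrom
    {U | ∃ (n : ℕ) (f : Fin n ↪ K) (A : L.Structure (Fin n)), U = {x | pull x f = A}}

variable {K : Type u}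

/-- The group `Aut K`, with `g * h = g ∘ h`. -/
instance autGroup {L : FirstOrder.Language} [L.Structure K] : Group (K ≃[L] K) where
  mul g h := g.comp h
  one := Language.Equiv.refl L K
  inv g := g.symm
  mul_assoc _ _ _ := rfl
  one_mul _ := rfl
  mul_one _ := rfl
  inv_mul_cancel g := by
    ext a
    exact g.symm_apply_apply a

/-- The topology of pointwise convergence on `Aut K`, where `K` is discrete. -/
instance autTopology {L : FirstOrder.Language} [L.Structure K] : TopologicalSpace (K ≃[L] K) :=
  TopologicalSpace.induced (fun g : K ≃[L] K => (g : K → K))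
    (@Pi.topologicalSpace K (fun _ => K) fun _ => ⊥)

theorem isOpen_aut {L : FirstOrder.Language} [L.Structure K] (a b : K) :
    IsOpen {g : K ≃[L] K | g a = b} := by
  let : TopologicalSpace K := ⊥
  have : DiscreteTopology K := ⟨rfl⟩
  have h : Continuous fun g : K ≃[L] K => g a := (continuous_apply a).comp continuous_induced_dom
  exact (isOpen_discrete {b}).preimage h

theorem continuous_aut_iff {L : FirstOrder.Language} [L.Structure K] {T : Type*} [TopologicalSpace T]
    (F : T → (K ≃[L] K)) : Continuous F ↔ ∀ a b : K, IsOpen {t | F t a = b} := by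
  refine ⟨fun h a b => (isOpen_aut a b).preimage h, fun h => ?_⟩
  let : TopologicalSpace K := ⊥
  have : DiscreteTopology K := ⟨rfl⟩
  refine continuous_induced_rng.2 (continuous_pi fun a => ?_)
  exact continuous_discrete_rng.2 fun b => h a b

instance autTopologicalGroup {L : FirstOrder.Language} [L.Structure K] : IsTopologicalGroup (K ≃[L] K) where
  continuous_mul := by
    refine (continuous_aut_iff _).2 fun a b => ?_
    have : {p : (K ≃[L] K) × (K ≃[L] K) | (p.1 * p.2) a = b} =
        ⋃ c : K, {p | p.1 c = b} ∩ {p | p.2 a = c} := by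
      ext p
      simp only [mem_ofPred_eq, mem_iUnion, mem_inter_iff]
      exact ⟨fun h => ⟨p.2 a, h, rfl⟩, fun ⟨c, h, hc⟩ => by subst hc; exact h⟩
    rw [this]
    exact isOpen_iUnion fun c => ((isOpen_aut c b).preimage continuous_fst).inter
      ((isOpen_aut a c).preimage continuous_snd)
  continuous_inv := by
    refine (continuous_aut_iff _).2 fun a b => ?_
    have : {g : K ≃[L] K | g⁻¹ a = b} = {g | g b = a} := by
      ext g
      exact ⟨fun h => by rw [mem_ofPred_eq, ← h]; exact g.apply_symm_apply a,
        fun h => by rw [mem_ofPred_eq, ← h]; exact g.symm_apply_apply b⟩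
    rw [this]
    exact isOpen_aut b a

/-- The right action of `Aut K` on the space of `L'`-structures on `K` (for any relational
language `L'`): `R` holds of `a` in `x · g` iff `R` holds of `g ∘ a` in `x`. -/
instance structAction {L : FirstOrder.Language} [L.Structure K] {L' : FirstOrder.Language} [L'.IsRelational] :
    MulAction (K ≃[L] K)ᵐᵒᵖ (L'.Structure K) where
  smul g x := pull x g.unop
  one_smul x := by
    refine Structure.ext ?_ rfl
    funext n F
    exact isEmptyElim F
  mul_smul _ _ _ := rfl

instance structContinuousConstSMul {L : FirstOrder.Language} [L.Structure K] {L' : FirstOrder.Language}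
    [L'.IsRelational] : ContinuousConstSMul (K ≃[L] K)ᵐᵒᵖ (L'.Structure K) where
  continuous_const_smul g := by
    refine continuous_generateFrom_iff.2 ?_
    rintro _ ⟨n, f, A, rfl⟩
    exact TopologicalSpace.isOpen_generateFrom_of_mem
      ⟨n, f.trans g.unop.toEquiv.toEmbedding, A, rfl⟩

/-- A Fraïssé structure: countable, and every embedding into `K` of a finite substructure of `K`
extends to an automorphism. (In a relational language, finitely generated means finite.) -/
structure IsFraisseStructure (L : FirstOrder.Language) [L.IsRelational] (K : Type*) [L.Structure K] :
    Prop where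
  countable : Countable K
  homogeneous : L.IsUltrahomogeneous K

/-- The partition relation `K → (K)^A_{r,ℓ}`. -/
def Arrow (L : FirstOrder.Language) (K A : Type*) [L.Structure K] [L.Structure A] (r ℓ : ℕ) : Prop :=
  ∀ γ : (A ↪[L] K) → Fin r, ∃ η : K ↪[L] K, (range fun f : A ↪[L] K => γ (η.comp f)).ncard ≤ ℓ

/-- `A` has big Ramsey degree `ℓ` in `K`. -/
def HasBigRamseyDegree (L : FirstOrder.Language) (K A : Type*) [L.Structure K] [L.Structure A] (ℓ : ℕ) :
    Prop :=
  IsLeast {ℓ : ℕ | ∀ r > ℓ, Arrow L K A r ℓ} ℓ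

/-- `K'(A)`: the set of `L'`-expansions of `A` which embed into `K'`. -/
def expansions {L' : FirstOrder.Language} (φ : L →ᴸ L') (K' : L'.Structure K) (A : Type*) [iA : L.Structure A] :
    Set (L'.Structure A) :=
  {x | reduct φ x = iA ∧ Nonempty (@Language.Embedding L' A K x K')}

/-- `K'` is a big Ramsey structure for `K`, in the language `L'`, which contains `L` via `φ`.
The class `Age K` consists of the finite `A` which embed into `K`. -/
structure IsBigRamseyStructure [iK : L.Structure K] {L' : FirstOrder.Language} [L'.IsRelational]
    (φ : L →ᴸ L') (K' : L'.Structure K) : Prop where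
  /-- `φ` is an inclusion of languages -/
  injective : φ.Injective
  /-- `K'` is an expansion of `K` -/
  reduct_eq : reduct φ K' = iK
  finite_expansions : ∀ (A : Type u) [L.Structure A] [Finite A], Nonempty (A ↪[L] K) →
    (expansions φ K' A).Finite
  bigRamseyDegree : ∀ (A : Type u) [L.Structure A] [Finite A], Nonempty (A ↪[L] K) →
    HasBigRamseyDegree L K A (expansions φ K' A).ncard
  /-- the coloring `f ↦ K' · f` of `Emb(A, K)` witnesses that the big Ramsey degree of `A` is not
  less than `|K'(A)|`: no `η ∈ Emb(K)` reduces it to fewer than `|K'(A)|` colors -/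
  witness : ∀ (A : Type u) [L.Structure A] [Finite A], Nonempty (A ↪[L] K) →
    ∀ η : K ↪[L] K, (expansions φ K' A).ncard ≤
      (range fun f : A ↪[L] K => pull K' (η.comp f)).ncard

/-- The space `X_{K'}`, the closure of `K' · Aut K` in the space of `L'`-structures on `K`. -/
abbrev BigRamseySpace (L : FirstOrder.Language) [L.Structure K] {L' : FirstOrder.Language} [L'.IsRelational]
    (K' : L'.Structure K) : Type _ :=
  orbitClosure (K ≃[L] K) K'

/-- The point `K'` of `X_{K'}`. -/
def basePoint (L : FirstOrder.Language) [L.Structure K] {L' : FirstOrder.Language} [L'.IsRelational]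
    (K' : L'.Structure K) : BigRamseySpace L K' :=
  ⟨K', subset_closure ⟨1, one_smul _ K'⟩⟩

/-- `K` admits a big Ramsey structure. -/
def AdmitsBigRamseyStructure (L : FirstOrder.Language.{c, d}) [L.IsRelational] (K : Type u) [L.Structure K] :
    Prop :=
  ∃ (L' : FirstOrder.Language.{a, b}) (_ : L'.IsRelational) (φ : L →ᴸ L') (K' : L'.Structure K),
    IsBigRamseyStructure φ K'

/-- `(Z, z₀)` is a big Ramsey ambit: it is isomorphic to `(X_{K'}, K')` for some big Ramsey
structure `K'` for `K`. -/
def IsBigRamseyAmbit (L : FirstOrder.Language.{c, d}) [L.IsRelational] (K : Type u) [L.Structure K]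
    {Z : Type*} [TopologicalSpace Z] [MulAction (K ≃[L] K)ᵐᵒᵖ Z] (z₀ : Z) : Prop :=
  ∃ (L' : FirstOrder.Language.{a, b}) (_ : L'.IsRelational) (φ : L →ᴸ L') (K' : L'.Structure K),
    IsBigRamseyStructure φ K' ∧ AmbitIso (K ≃[L] K) z₀ (basePoint L K')

/-- `Z` is a big Ramsey flow: the underlying flow of a big Ramsey ambit. -/
def IsBigRamseyFlow (L : FirstOrder.Language.{c, d}) [L.IsRelational] (K : Type u) [L.Structure K]
    (Z : Type*) [TopologicalSpace Z] [MulAction (K ≃[L] K)ᵐᵒᵖ Z] : Prop :=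
  ∃ z₀ : Z, IsBigRamseyAmbit.{u, a, b} L K z₀

end Structures

end BigRamsey

end

/-! Points of the left completion of `Aut K` are represented by self-embeddings η of `K`, and such
an η acts on a structure by pulling it back along η. Finiteness of `K'(A)` and the witness condition
say that every expansion of `A` in `K'` still occurs in `K' · η`. Hence every `K' · η` has dense
orbit in `X_{K'}`, that is, `K'` is a completion point.

For universality, let `y` be a completion point of a flow `Y`. Up to a given entourage, the point `y
· g` depends only on a finite color of the restriction of `g` to some finite `s`
(`exists_coloring`). Pair this coloring with `f ↦ K' · f`. The big Ramsey degree gives η leaving at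
most `|K'(s)|` pairs; since all first coordinates survive, the second coordinate becomes a function
of the first (`exists_factor`). So along the orbits of `K' · η` and `y · η`, which are both dense,
the restriction to `s` determines the point of `Y` up to the entourage. Finitely many entourages can
be treated by one η, and an ultralimit of these approximate maps is a surjective `G`-map
(`exists_surjective_flowMap`).

Uniqueness rests on coalescence of `X_{K'}` (`injective_of_surjective`). For a surjective
endomorphism σ, the same factoring argument shows that the restriction of `σ x` to `s` depends only
on that of `x`. The induced surjection of a finite set is a bijection, so σ is injective.
Surjections both ways between `X_{K'}` and a universal completion flow are then isomorphisms. -/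

namespace BigRamsey

open FirstOrder Language

/-! ### The logic topology through restrictions to finite sets -/

section LogicTopology

variable {L' : FirstOrder.Language} [L'.IsRelational] {K : Type u}

theorem pull_eq_pull_iff {A B : Type*} {x y : L'.Structure B} {f g : A → B} :
    pull x f = pull y g ↔
      ∀ (n : ℕ) (R : L'.Relations n) (t : Fin n → A), x.RelMap R (f ∘ t) = y.RelMap R (g ∘ t) := by
  constructor
  · intro h n R t
    have := congrArg (fun z : L'.Structure A => z.RelMap R t) h
    exact this
  · intro h
    refine Structure.ext ?_ ?_
    · funext n F
      exact isEmptyElim F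
    · funext n R t
      exact h n R t

/-- The substructure of `x` on the finite set `s`. -/
abbrev restr (s : Finset K) (x : L'.Structure K) : L'.Structure s :=
  pull x Subtype.val

theorem restr_eq_iff {s : Finset K} {x y : L'.Structure K} :
    restr s x = restr s y ↔
      ∀ (n : ℕ) (R : L'.Relations n) (t : Fin n → K), (∀ i, t i ∈ s) →
        x.RelMap R t = y.RelMap R t := by
  rw [pull_eq_pull_iff]
  exact ⟨fun h n R t ht => h n R fun i => ⟨t i, ht i⟩, fun h n R t => h n R _ fun i => (t i).2⟩

theorem restr_mono {s t : Finset K} (hst : s ⊆ t) {x y : L'.Structure K}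
    (h : restr t x = restr t y) : restr s x = restr s y :=
  restr_eq_iff.2 fun n R p hp => restr_eq_iff.1 h n R p fun i => hst (hp i)

theorem restr_pull_congr {s : Finset K} (x : L'.Structure K) {f g : K → K}
    (h : ∀ a ∈ s, f a = g a) : restr s (pull x f) = restr s (pull x g) := by
  refine restr_eq_iff.2 fun n R t ht => ?_
  have : f ∘ t = g ∘ t := funext fun i => h _ (ht i)
  change x.RelMap R (f ∘ t) = x.RelMap R (g ∘ t)
  rw [this]

theorem restr_pull_eq_of_image [DecidableEq K] {s : Finset K} {x y : L'.Structure K} {f : K → K}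
    (h : restr (s.image f) x = restr (s.image f) y) :
    restr s (pull x f) = restr s (pull y f) :=
  restr_eq_iff.2 fun n R t ht =>
    restr_eq_iff.1 h n R (f ∘ t) fun i => Finset.mem_image_of_mem f (ht i)

theorem pull_eq_pull_iff_restr [DecidableEq K] {n : ℕ} (f : Fin n → K) {x y : L'.Structure K} :
    pull x f = pull y f ↔ restr (Finset.univ.image f) x = restr (Finset.univ.image f) y := by
  rw [pull_eq_pull_iff, restr_eq_iff]
  constructor
  · intro h m R t ht
    have ht' : ∀ i, ∃ j, f j = t i := fun i => by simpa using ht i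
    choose p hp using ht'
    have : t = f ∘ p := funext fun i => (hp i).symm
    rw [this]
    exact h m R p
  · intro h m R t
    exact h m R _ fun i => Finset.mem_image_of_mem f (Finset.mem_univ _)

theorem isOpen_restr_eq (s : Finset K) (A : L'.Structure s) :
    IsOpen {x : L'.Structure K | restr s x = A} := by
  classical
  refine isOpen_iff_forall_mem_open.2 fun x hx => ?_
  let f : Fin s.card ↪ K := s.equivFin.symm.toEmbedding.trans (Function.Embedding.subtype _)
  have hf : Finset.univ.image f = s := by
    ext a
    simp only [Finset.mem_image, Finset.mem_univ, true_and]
    constructor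
    · rintro ⟨i, rfl⟩
      exact (s.equivFin.symm i).2
    · intro ha
      exact ⟨s.equivFin ⟨a, ha⟩, by simp [f]⟩
  refine ⟨{y | pull y f = pull x f}, fun y hy => ?_,
    TopologicalSpace.isOpen_generateFrom_of_mem ⟨_, f, _, rfl⟩, rfl⟩
  have := (pull_eq_pull_iff_restr f).1 hy
  rw [hf] at this
  exact this.trans hx

theorem exists_restr_subset {U : Set (L'.Structure K)} (hU : IsOpen U) {x : L'.Structure K}
    (hx : x ∈ U) : ∃ s : Finset K, ∀ y, restr s y = restr s x → y ∈ U := by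
  classical
  induction hU with
  | basic V hV =>
    obtain ⟨n, f, A, rfl⟩ := hV
    exact ⟨Finset.univ.image f, fun y hy => ((pull_eq_pull_iff_restr f).2 hy).trans hx⟩
  | univ => exact ⟨∅, fun _ _ => trivial⟩
  | inter V W _ _ hV hW =>
    obtain ⟨s, hs⟩ := hV hx.1
    obtain ⟨t, ht⟩ := hW hx.2
    exact ⟨s ∪ t, fun y hy => ⟨hs y (restr_mono Finset.subset_union_left hy),
      ht y (restr_mono Finset.subset_union_right hy)⟩⟩
  | sUnion S _ ih =>
    obtain ⟨V, hV, hxV⟩ := hx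
    obtain ⟨s, hs⟩ := ih V hV hxV
    exact ⟨s, fun y hy => ⟨V, hV, hs y hy⟩⟩

theorem tendsto_structure_iff {T : Type*} {l : Filter T} {F : T → L'.Structure K}
    {x : L'.Structure K} :
    Tendsto F l (𝓝 x) ↔ ∀ s : Finset K, ∀ᶠ i in l, restr s (F i) = restr s x := by
  constructor
  · intro h s
    exact h ((isOpen_restr_eq s _).mem_nhds rfl)
  · intro h U hU
    obtain ⟨V, hVU, hV, hxV⟩ := mem_nhds_iff.1 hU
    obtain ⟨s, hs⟩ := exists_restr_subset hV hxV
    exact (h s).mono fun i hi => hVU (hs _ hi)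

theorem mem_closure_structure_iff {S : Set (L'.Structure K)} {x : L'.Structure K} :
    x ∈ closure S ↔ ∀ s : Finset K, ∃ y ∈ S, restr s y = restr s x := by
  rw [mem_closure_iff]
  constructor
  · intro h s
    obtain ⟨y, hy, hyS⟩ := h _ (isOpen_restr_eq s (restr s x)) rfl
    exact ⟨y, hyS, hy⟩
  · intro h U hU hx
    obtain ⟨s, hs⟩ := exists_restr_subset hU hx
    obtain ⟨y, hyS, hy⟩ := h s
    exact ⟨y, hs y hy, hyS⟩

theorem structure_ext_restr {x y : L'.Structure K} (h : ∀ s : Finset K, restr s x = restr s y) :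
    x = y := by
  classical
  refine Structure.ext ?_ ?_
  · funext n F
    exact isEmptyElim F
  · funext n R t
    exact restr_eq_iff.1 (h (Finset.univ.image t)) n R t fun i =>
      Finset.mem_image_of_mem t (Finset.mem_univ i)

instance t2Space_structure : T2Space (L'.Structure K) := by
  refine ⟨fun x y hxy => ?_⟩
  obtain ⟨s, hs⟩ : ∃ s : Finset K, restr s x ≠ restr s y := by
    by_contra! h
    exact hxy (structure_ext_restr h)
  refine ⟨_, _, isOpen_restr_eq s (restr s x), isOpen_restr_eq s (restr s y), rfl, rfl, ?_⟩
  rw [disjoint_left]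
  intro z hz hz'
  exact hs (hz.symm.trans hz')

/-- Along an ultrafilter each finite restriction is eventually constant, having finitely many
values; these constant values fit together into a limit structure. -/
theorem isCompact_of_finite_restr {S : Set (L'.Structure K)} (hS : IsClosed S)
    (hfin : ∀ s : Finset K, (restr s '' S).Finite) : IsCompact S := by
  rw [isCompact_iff_ultrafilter_le_nhds']
  intro U hU
  have key : ∀ s : Finset K, ∃ A : L'.Structure s, ∀ᶠ x in (U : Filter _), restr s x = A := by
    intro s
    have h : restr s '' S ∈ U.map (restr s) :=
      Filter.mem_map.2 (mem_of_superset hU (subset_preimage_image _ _))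
    obtain ⟨A, -, hA⟩ := (Ultrafilter.eq_pure_of_finite_mem (hfin s) h)
    refine ⟨A, ?_⟩
    have h' : ({A} : Set _) ∈ U.map (restr s) := by
      rw [hA]
      exact mem_singleton A
    exact h'
  choose A hA using key
  let y : L'.Structure K :=
    { funMap := fun {_} F => isEmptyElim F
      RelMap := fun {n} R t => ∀ᶠ x in (U : Filter (L'.Structure K)), x.RelMap R t }
  have hy : (U : Filter _) ≤ 𝓝 y := by
    refine tendsto_id'.1 (tendsto_structure_iff.2 fun s => ?_)
    filter_upwards [hA s] with x hx
    refine restr_eq_iff.2 fun n R t ht => propext ?_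
    change x.RelMap R t ↔ ∀ᶠ x in (U : Filter (L'.Structure K)), x.RelMap R t
    have h : ∀ᶠ z in (U : Filter (L'.Structure K)), (x.RelMap R t ↔ z.RelMap R t) := by
      filter_upwards [hA s] with z hz
      rw [restr_eq_iff.1 (hx.trans hz.symm) n R t ht]
    rw [← eventually_congr h, eventually_const]
  exact ⟨y, hS.mem_of_tendsto (hy : Tendsto id _ _) hU, hy⟩

end LogicTopology

/-! ### Pointwise convergence and extension of finite partial maps -/

section Aut

variable {L : FirstOrder.Language} {K : Type u} [L.Structure K]

theorem setOf_agree_mem_nhds (s : Finset K) (g : K ≃[L] K) :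
    {h : K ≃[L] K | ∀ a ∈ s, h a = g a} ∈ 𝓝 g :=
  (Filter.eventually_all_finset s).2 fun a _ => (isOpen_aut a (g a)).mem_nhds rfl

theorem exists_agree_subset {g : K ≃[L] K} {U : Set (K ≃[L] K)} (hU : U ∈ 𝓝 g) :
    ∃ s : Finset K, {h : K ≃[L] K | ∀ a ∈ s, h a = g a} ⊆ U := by
  let : TopologicalSpace K := ⊥
  have : DiscreteTopology K := ⟨rfl⟩
  obtain ⟨V, hV, hVU⟩ := (mem_nhds_induced (fun g : K ≃[L] K => (g : K → K)) g U).1 hU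
  rw [nhds_pi, Filter.mem_pi] at hV
  obtain ⟨I, hI, t, ht, htV⟩ := hV
  refine ⟨hI.toFinset, fun h hh => hVU (htV fun i hi => ?_)⟩
  have : h i = g i := hh i (by simpa using hi)
  change h i ∈ t i
  rw [this]
  exact mem_of_mem_nhds (ht i)

theorem exists_aut_extending [L.IsRelational] (hK : L.IsUltrahomogeneous K) (s : Finset K) (f : K → K)
    (hf : ∀ a ∈ s, ∀ b ∈ s, f a = f b → a = b)
    (hrel : ∀ (n : ℕ) (R : L.Relations n) (t : Fin n → K), (∀ i, t i ∈ s) →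
      (Structure.RelMap R (f ∘ t) ↔ Structure.RelMap R t)) :
    ∃ g : K ≃[L] K, ∀ a ∈ s, g a = f a := by
  let S : L.Substructure K := ⟨s, fun F => isEmptyElim F⟩
  have hS : S.FG := ⟨s, SetLike.coe_injective (Substructure.closure_eq_of_isRelational L _)⟩
  let e : S ↪[L] K :=
    { toFun := fun a => f a
      inj' := fun a b hab => Subtype.ext (hf a a.2 b b.2 hab)
      map_fun' := fun F => isEmptyElim F
      map_rel' := fun {n} R t => hrel n R (fun i => t i) fun i => (t i).2 }
  obtain ⟨g, hg⟩ := hK S hS e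
  refine ⟨g, fun a ha => ?_⟩
  have := DFunLike.congr_fun hg (⟨a, ha⟩ : S)
  exact this.symm

theorem exists_aut_agree [L.IsRelational] (hK : L.IsUltrahomogeneous K) (s : Finset K) (η : K ↪[L] K) :
    ∃ g : K ≃[L] K, ∀ a ∈ s, g a = η a :=
  exists_aut_extending hK s η (fun _ _ _ _ h => η.injective h) fun _ R t _ => η.map_rel R t

end Aut

/-! ### General flows, completion flows and change of universe -/

section Flows

variable {G : Type*} [Group G]
  {X : Type*} [TopologicalSpace X] [MulAction Gᵐᵒᵖ X]
  {Y : Type*} [TopologicalSpace Y] [MulAction Gᵐᵒᵖ Y]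
  {Z : Type*} [TopologicalSpace Z] [MulAction Gᵐᵒᵖ Z]

theorem IsFlowMap.comp {ψ : Y → Z} {φ : X → Y} (hψ : IsFlowMap G ψ) (hφ : IsFlowMap G φ) :
    IsFlowMap G (ψ ∘ φ) :=
  ⟨hψ.continuous.comp hφ.continuous, fun x g => by simp [hφ.map_act, hψ.map_act]⟩

theorem FlowIso.symm (h : FlowIso G X Y) : FlowIso G Y X := by
  obtain ⟨e, he⟩ := h
  refine ⟨e.symm, e.symm.continuous, fun y g => ?_⟩
  rw [Homeomorph.symm_apply_eq, he.map_act, e.apply_symm_apply]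

theorem FlowIso.trans (h : FlowIso G X Y) (h' : FlowIso G Y Z) : FlowIso G X Z := by
  obtain ⟨e, he⟩ := h
  obtain ⟨e', he'⟩ := h'
  exact ⟨e.trans e', he'.comp he⟩

theorem HasDenseOrbit.map {φ : X → Y} (hφ : IsFlowMap G φ) (hs : Function.Surjective φ) {x : X}
    (hx : HasDenseOrbit G x) : HasDenseOrbit G (φ x) := by
  have := hs.denseRange.dense_image hφ.continuous hx
  rw [← range_comp] at this
  refine this.mono ?_
  rintro _ ⟨g, rfl⟩
  exact ⟨g, (hφ.map_act x g).symm⟩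

/-- A point `y` is determined by the family of sets `S ⊆ G` with `y` in the closure of `x · S`, so
`X` injects into the double power set of `G`. This lets a flow be replaced by a copy in the universe
over which universality quantifies. -/
theorem HasDenseOrbit.small [Small.{v} G] [T2Space X] {x : X} (hx : HasDenseOrbit G x) :
    Small.{v} X := by
  let F : X → Set (Set G) := fun y => {S | y ∈ closure ((fun g : G => op g • x) '' S)}
  refine small_of_injective (f := F) fun y z hyz => ?_
  by_contra hne
  obtain ⟨U, V, hU, hV, hyU, hzV, hUV⟩ := t2_separation hne
  have hy : {g : G | op g • x ∈ U} ∈ F y := by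
    refine mem_closure_iff.2 fun W hW hyW => ?_
    obtain ⟨_, ⟨hW', hU'⟩, g, rfl⟩ := hx.inter_open_nonempty _ (hW.inter hU) ⟨y, hyW, hyU⟩
    exact ⟨_, hW', g, hU', rfl⟩
  rw [hyz] at hy
  obtain ⟨_, hV', g, hU', rfl⟩ := mem_closure_iff.1 hy V hV hzV
  exact hUV.le_bot ⟨hU', hV'⟩

theorem flowIso_shrink [Small.{v} X] : FlowIso G X (Shrink.{v} X) :=
  ⟨Shrink.homeomorph X, (Shrink.homeomorph X).continuous, fun x g => by
    change equivShrink X _ = equivShrink X (op g • (equivShrink X).symm (equivShrink X x))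
    rw [Equiv.symm_apply_apply]⟩

variable [TopologicalSpace G]

theorem IsFlow.of_flowIso (h : FlowIso G X Y) (hX : IsFlow G X) : IsFlow G Y := by
  obtain ⟨e, he⟩ := h
  have := hX.compact
  have := hX.hausdorff
  refine ⟨e.compactSpace, e.t2Space, ?_⟩
  have : (fun p : Y × G => op p.2 • p.1) = fun p : Y × G => e (op p.2 • e.symm p.1) := by
    funext p
    rw [he.map_act, e.apply_symm_apply]
  rw [this]
  exact e.continuous.comp (hX.continuous_act.comp
    ((e.symm.continuous.comp continuous_fst).prodMk continuous_snd))

theorem IsFlow.continuous_const_act (hX : IsFlow G X) (g : G) :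
    Continuous fun x : X => op g • x :=
  hX.continuous_act.comp (Continuous.prodMk_left g)

theorem flowIso_of_bijective {φ : X → Y} (hX : IsFlow G X) (hY : IsFlow G Y)
    (hφ : IsFlowMap G φ) (hb : Function.Bijective φ) : FlowIso G X Y := by
  have := hX.compact
  have := hY.hausdorff
  exact ⟨hφ.continuous.homeoOfEquivCompactToT2 (f := Equiv.ofBijective φ hb), hφ⟩

variable [IsTopologicalGroup G]

theorem denseRange_toLeftCompletion : DenseRange (toLeftCompletion G) :=
  (isDenseInducing_toLeftCompletion G).dense

theorem IsFlowMap.map_completionAct {φ : X → Y} (hX : IsFlow G X) (hY : IsFlow G Y)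
    (hφ : IsFlowMap G φ) (x : X) (η : LeftCompletion G) :
    φ (completionAct x η) = completionAct (φ x) η := by
  have := hY.hausdorff
  refine congrFun (denseRange_toLeftCompletion.equalizer
    (hφ.continuous.comp (continuous_completionAct hX x)) (continuous_completionAct hY (φ x)) ?_) η
  funext g
  simp only [Function.comp_apply]
  rw [completionAct_coe hX, completionAct_coe hY, hφ.map_act]

theorem tendsto_completionAct (hX : IsFlow G X) (x : X) {η : LeftCompletion G} {l : Filter G}
    (hl : Tendsto (toLeftCompletion G) l (𝓝 η)) :
    Tendsto (fun g : G => op g • x) l (𝓝 (completionAct x η)) := by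
  have := ((continuous_completionAct hX x).tendsto η).comp hl
  exact this.congr fun g => completionAct_coe hX x g

theorem IsCompletionPoint.hasDenseOrbit (hX : IsFlow G X) {x : X} (hx : IsCompletionPoint G x) :
    HasDenseOrbit G x := by
  have := hx (toLeftCompletion G 1)
  rwa [completionAct_coe hX, op_one, one_smul] at this

theorem IsCompletionFlow.of_surjective {φ : X → Y} (hX : IsCompletionFlow G X) (hY : IsFlow G Y)
    (hφ : IsFlowMap G φ) (hs : Function.Surjective φ) : IsCompletionFlow G Y := by
  obtain ⟨x, hx⟩ := hX.exists_point
  refine ⟨hY, φ x, fun η => ?_⟩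
  rw [← hφ.map_completionAct hX.isFlow hY]
  exact (hx η).map hφ hs

theorem IsCompletionFlow.of_flowIso (h : FlowIso G X Y) (hX : IsCompletionFlow G X) :
    IsCompletionFlow G Y := by
  obtain ⟨e, he⟩ := id h
  exact hX.of_surjective (hX.isFlow.of_flowIso h) he e.surjective

theorem IsUniversalCompletionFlow.of_flowIso (h : FlowIso G X Y)
    (hX : IsUniversalCompletionFlow.{v} G X) : IsUniversalCompletionFlow.{v} G Y := by
  refine ⟨hX.isCompletionFlow.of_flowIso h, fun Z _ _ hZ => ?_⟩
  obtain ⟨e, he⟩ := h.symm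
  obtain ⟨φ, hφ, hs⟩ := hX.exists_map Z hZ
  exact ⟨φ ∘ e, hφ.comp he, hs.comp e.surjective⟩

theorem IsCompletionFlow.small [Small.{v} G] (hX : IsCompletionFlow G X) : Small.{v} X := by
  obtain ⟨x, hx⟩ := hX.exists_point
  have := hX.isFlow.hausdorff
  exact (hx.hasDenseOrbit hX.isFlow).small

/-- Universality does not depend on the universe in which the targets live. -/
theorem IsUniversalCompletionFlow.exists_map' [Small.{v} G]
    (hX : IsUniversalCompletionFlow.{v} G X) (hY : IsCompletionFlow G Y) :
    ∃ φ : X → Y, IsFlowMap G φ ∧ Function.Surjective φ := by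
  have := hY.small
  obtain ⟨φ, hφ, hs⟩ := hX.exists_map (Shrink.{v} Y) (hY.of_flowIso flowIso_shrink)
  obtain ⟨e, he⟩ := (flowIso_shrink (G := G) (X := Y)).symm
  exact ⟨e ∘ φ, he.comp hφ, e.surjective.comp hs⟩

end Flows

/-! ### The left completion of `Aut K` as self-embeddings of `K` -/

section Completion

variable {L : FirstOrder.Language} {K : Type u} [L.Structure K]

/-- The embedding `η` of `K` represents the point `ξ` of the left completion of `Aut K`. -/
def Represents (η : K ↪[L] K) (ξ : LeftCompletion (K ≃[L] K)) : Prop :=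
  ∃ l : Filter (K ≃[L] K), l.NeBot ∧ Tendsto (toLeftCompletion (K ≃[L] K)) l (𝓝 ξ) ∧
    ∀ a : K, ∀ᶠ g in l, g a = η a

theorem exists_represented [L.IsRelational] (hK : L.IsUltrahomogeneous K) (η : K ↪[L] K) :
    ∃ ξ, Represents η ξ := by
  -- The filter of automorphisms agreeing with η on larger and larger finite sets; ultrahomogeneity
  -- makes it proper.
  let l : Filter (K ≃[L] K) :=
    comap (fun (g : K ≃[L] K) (a : K) => g a) (Filter.pi fun a => pure (η a))
  have hev : ∀ a : K, ∀ᶠ g in l, g a = η a := fun a =>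
    ((tendsto_eval_pi (fun a => pure (η a)) a).comp tendsto_comap) (mem_pure.2 rfl : {η a} ∈ _)
  have hne : l.NeBot := by
    rw [comap_neBot_iff]
    intro t ht
    obtain ⟨I, hI, s, hs, hst⟩ := Filter.mem_pi.1 ht
    obtain ⟨g, hg⟩ := exists_aut_agree hK hI.toFinset η
    refine ⟨g, hst fun a ha => ?_⟩
    rw [hg a (by simpa using ha)]
    exact hs a
  let := IsTopologicalGroup.leftUniformSpace (K ≃[L] K)
  have hc : Cauchy l := by
    refine ⟨hne, ?_⟩
    rintro W ⟨V, hV, hVW⟩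
    obtain ⟨s, hs⟩ := exists_agree_subset hV
    have hmem : {g : K ≃[L] K | ∀ a ∈ s, g a = η a} ∈ l :=
      (Filter.eventually_all_finset s).2 fun a _ => hev a
    refine mem_of_superset (prod_mem_prod hmem hmem) ?_
    rintro ⟨g, h⟩ ⟨hg, hh⟩
    refine hVW (hs fun a ha => ?_)
    change g.symm (h a) = a
    rw [hh a ha, ← hg a ha, g.symm_apply_apply]
  obtain ⟨ξ, hξ⟩ := CompleteSpace.complete
    (hc.map (UniformSpace.Completion.uniformContinuous_coe (K ≃[L] K)))
  exact ⟨ξ, l, hne, hξ, hev⟩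

/-- Left Cauchy means that `g⁻¹ * h` eventually fixes any given `a`, so `g a` is eventually
constant. The pointwise limit is an embedding, but need not be onto. -/
theorem exists_representing [L.IsRelational] (ξ : LeftCompletion (K ≃[L] K)) :
    ∃ η : K ↪[L] K, Represents η ξ := by
  let := IsTopologicalGroup.leftUniformSpace (K ≃[L] K)
  let l : Filter (K ≃[L] K) := comap (toLeftCompletion (K ≃[L] K)) (𝓝 ξ)
  have hne : l.NeBot := (isDenseInducing_toLeftCompletion (K ≃[L] K)).comap_nhds_neBot ξ
  have hc : Cauchy l := cauchy_nhds.comap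
    (UniformSpace.Completion.isUniformInducing_coe (K ≃[L] K)).comap_uniformity.le
  have key : ∀ a : K, ∃ b : K, ∀ᶠ g in l, g a = b := by
    intro a
    have hV : {p : (K ≃[L] K) × (K ≃[L] K) | (p.1⁻¹ * p.2) a = a} ∈ uniformity (K ≃[L] K) :=
      ⟨_, (isOpen_aut a a).mem_nhds rfl, Subset.rfl⟩
    obtain ⟨S, hS, hSV⟩ := (cauchy_iff.1 hc).2 _ hV
    obtain ⟨g, hg⟩ := hne.nonempty_of_mem hS
    refine ⟨g a, mem_of_superset hS fun h hh => ?_⟩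
    have : g.symm (h a) = a := hSV (mk_mem_prod hg hh)
    change h a = g a
    rw [← g.apply_symm_apply (h a), this]
  choose f hf using key
  have hrel : ∀ {n : ℕ} (t : Fin n → K), ∀ᶠ g : K ≃[L] K in l, (g : K → K) ∘ t = f ∘ t := fun t => by
    filter_upwards [Filter.eventually_all.2 fun i => hf (t i)] with g hg using funext hg
  refine ⟨{ toFun := f, inj' := ?_, map_fun' := fun F => isEmptyElim F, map_rel' := ?_ },
    l, hne, tendsto_comap, hf⟩
  · intro a b hab
    obtain ⟨g, hga, hgb⟩ := ((hf a).and (hf b)).exists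
    exact g.injective (hga.trans (hab.trans hgb.symm))
  · intro n R t
    obtain ⟨g, hg⟩ := (hrel t).exists
    rw [← hg]
    exact g.map_rel R t

variable {X : Type*} [TopologicalSpace X] [MulAction (K ≃[L] K)ᵐᵒᵖ X]

theorem Represents.act_mul (hX : IsFlow (K ≃[L] K) X) {η : K ↪[L] K}
    {ξ : LeftCompletion (K ≃[L] K)} (h : Represents η ξ) (x : X) :
    ∃ l : Filter (K ≃[L] K), l.NeBot ∧ (∀ a : K, ∀ᶠ g in l, g a = η a) ∧
      ∀ g : K ≃[L] K, Tendsto (fun h : K ≃[L] K => op (h * g) • x) l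
        (𝓝 (op g • completionAct x ξ)) := by
  obtain ⟨l, hl, hlim, hev⟩ := h
  refine ⟨l, hl, hev, fun g => ?_⟩
  have := ((hX.continuous_const_act g).tendsto _).comp (tendsto_completionAct hX x hlim)
  exact this.congr fun h => by simp [mul_smul]

end Completion

/-- A compactness principle producing factor maps. The locally constant maps `r j` generate the
topology of `X`, the entourages `W j` generate the uniformity of `Y`, and for every finite set of
indices there are points of `X` and `Y` with dense orbits such that, along these orbits,
`r j` determines points of `Y` up to `W j`. -/
theorem exists_surjective_flowMap {G : Type*} [Group G] [TopologicalSpace G]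
    {X : Type*} [TopologicalSpace X] [MulAction Gᵐᵒᵖ X]
    {Y : Type*} [UniformSpace Y] [MulAction Gᵐᵒᵖ Y]
    (hX : IsFlow G X) (hY : IsFlow G Y) {J : Type*} {τ : J → Type*}
    (r : ∀ j, X → τ j) (hr : ∀ j, IsLocallyConstant (r j))
    (hbasis : ∀ (p : X), ∀ N ∈ 𝓝 p, ∃ j, ∀ p', r j p' = r j p → p' ∈ N)
    (W : J → Set (Y × Y)) (hWc : ∀ j, IsClosed (W j)) (hWu : ∀ j, W j ∈ uniformity Y)
    (hW : ∀ V ∈ uniformity Y, ∃ j, W j ⊆ V)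
    (happrox : ∀ F : Finset J, ∃ (x : X) (y : Y), HasDenseOrbit G x ∧ HasDenseOrbit G y ∧
      ∀ j ∈ F, ∀ g h : G, r j (op g • x) = r j (op h • x) → (op g • y, op h • y) ∈ W j) :
    ∃ φ : X → Y, IsFlowMap G φ ∧ Function.Surjective φ := by
  classical
  have := hX.compact
  have := hY.compact
  have := hY.hausdorff
  choose x y hx hy hxy using happrox
  -- Refining `atTop` ensures that every index eventually lies in `F`, so each approximation
  -- condition holds in the limit.
  let 𝒰 : Ultrafilter (Finset J) := Ultrafilter.of atTop
  have hle : (𝒰 : Filter (Finset J)) ≤ atTop := Ultrafilter.of_le atTop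
  have hmem : ∀ j : J, ∀ᶠ F in (𝒰 : Filter (Finset J)), j ∈ F := fun j =>
    hle ((eventually_ge_atTop {j}).mono fun F hF => Finset.singleton_subset_iff.1 hF)
  have hlimX : ∀ f : Finset J → X, ∃ p, Tendsto f 𝒰 (𝓝 p) := fun f => by
    obtain ⟨p, -, hp⟩ := isCompact_univ.ultrafilter_le_nhds (𝒰.map f) (by simp)
    exact ⟨p, hp⟩
  have hlimY : ∀ f : Finset J → Y, ∃ q, Tendsto f 𝒰 (𝓝 q) := fun f => by
    obtain ⟨q, -, hq⟩ := isCompact_univ.ultrafilter_le_nhds (𝒰.map f) (by simp)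
    exact ⟨q, hq⟩
  have heq : ∀ q q' : Y, (∀ j, (q, q') ∈ W j) → q = q' := by
    intro q q' h
    refine eq_of_uniformity fun {V} hV => ?_
    obtain ⟨j, hj⟩ := hW V hV
    exact hj (h j)
  have hrnhds : ∀ (j : J) (p : X), ∀ᶠ p' in 𝓝 p, r j p' = r j p := fun j p =>
    (hr j).eventually_eq p
  have hclose : ∀ (j : J) (p p' : X) (g h : Finset J → G) (q q' : Y), r j p = r j p' →
      Tendsto (fun F => op (g F) • x F) 𝒰 (𝓝 p) → Tendsto (fun F => op (h F) • x F) 𝒰 (𝓝 p') →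
      Tendsto (fun F => op (g F) • y F) 𝒰 (𝓝 q) → Tendsto (fun F => op (h F) • y F) 𝒰 (𝓝 q') →
      (q, q') ∈ W j := by
    intro j p p' g h q q' hpp' hgp hhp hgq hhq
    refine (hWc j).mem_of_tendsto (hgq.prodMk_nhds hhq) ?_
    filter_upwards [hmem j, hgp (hrnhds j p), hhp (hrnhds j p')] with F hF hg hh
    exact hxy F j hF _ _ (hg.trans (hpp'.trans hh.symm))
  -- Density gives translates of `x F` converging to `p`; the limit of the same translates of `y F`
  -- will be the value at `p`. By `hclose` it is independent of the choice.
  have hex : ∀ p : X, ∃ (g : Finset J → G) (q : Y),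
      Tendsto (fun F => op (g F) • x F) 𝒰 (𝓝 p) ∧
      Tendsto (fun F => op (g F) • y F) 𝒰 (𝓝 q) := by
    intro p
    have h : ∀ F : Finset J, ∃ g : G, ∀ j ∈ F, r j (op g • x F) = r j p := by
      intro F
      have hN : ∀ᶠ p' in 𝓝 p, ∀ j ∈ F, r j p' = r j p :=
        (Filter.eventually_all_finset F).2 fun j _ => hrnhds j p
      obtain ⟨_, ⟨g, rfl⟩, hp'⟩ := (hx F).inter_nhds_nonempty hN
      exact ⟨g, hp'⟩
    choose g hg using h
    obtain ⟨q, hq⟩ := hlimY fun F => op (g F) • y F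
    refine ⟨g, q, fun N hN => ?_, hq⟩
    obtain ⟨j, hj⟩ := hbasis p N hN
    exact (hmem j).mono fun F hF => hj _ (hg F j hF)
  choose g φ hgp hgφ using hex
  have huniq : ∀ (p : X) (h : Finset J → G) (q : Y),
      Tendsto (fun F => op (h F) • x F) 𝒰 (𝓝 p) → Tendsto (fun F => op (h F) • y F) 𝒰 (𝓝 q) →
      φ p = q := fun p h q hp hq =>
    heq _ _ fun j => hclose j p p (g p) h _ _ rfl (hgp p) hp (hgφ p) hq
  refine ⟨φ, ⟨?_, ?_⟩, ?_⟩
  · refine continuous_iff_continuousAt.2 fun p => Uniform.tendsto_nhds_right.2 fun V hV => ?_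
    obtain ⟨j, hj⟩ := hW V hV
    exact (hrnhds j p).mono fun p' hp' =>
      hj (hclose j p p' _ _ _ _ hp'.symm (hgp p) (hgp p') (hgφ p) (hgφ p'))
  · intro p k
    refine huniq _ (fun F => g p F * k) _ ?_ ?_
    · exact (((hX.continuous_const_act k).tendsto p).comp (hgp p)).congr fun F => by
        simp [mul_smul]
    · exact (((hY.continuous_const_act k).tendsto (φ p)).comp (hgφ p)).congr fun F => by
        simp [mul_smul]
  · intro q
    -- Surjectivity exchanges the roles: approach `q` by translates of `y F`, and take the limit of
    -- the same translates of `x F` as preimage.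
    have h : ∀ F : Finset J, ∃ h : G, ∀ j ∈ F, (q, op h • y F) ∈ W j := by
      intro F
      have hN : ∀ᶠ q' in 𝓝 q, ∀ j ∈ F, (q, q') ∈ W j :=
        (Filter.eventually_all_finset F).2 fun j _ => UniformSpace.ball_mem_nhds q (hWu j)
      obtain ⟨_, ⟨h, rfl⟩, hq'⟩ := (hy F).inter_nhds_nonempty hN
      exact ⟨h, hq'⟩
    choose h hh using h
    obtain ⟨p, hp⟩ := hlimX fun F => op (h F) • x F
    refine ⟨p, huniq p h q hp (Uniform.tendsto_nhds_right.2 fun V hV => ?_)⟩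
    obtain ⟨j, hj⟩ := hW V hV
    exact (hmem j).mono fun F hF => hj (hh F j hF)

/-! ### Orbit closures of structures -/

section OrbitClosure

variable {L : FirstOrder.Language} {K : Type u} [L.Structure K]
  {L' : FirstOrder.Language} [L'.IsRelational] {K' : L'.Structure K}

theorem mem_orbitClosure_iff {x : L'.Structure K} :
    x ∈ orbitClosure (K ≃[L] K) K' ↔
      ∀ s : Finset K, ∃ g : K ≃[L] K, restr s (pull K' g) = restr s x := by
  refine mem_closure_structure_iff.trans ⟨fun h s => ?_, fun h s => ?_⟩
  · obtain ⟨_, ⟨g, rfl⟩, hg⟩ := h s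
    exact ⟨g, hg⟩
  · obtain ⟨g, hg⟩ := h s
    exact ⟨_, ⟨g, rfl⟩, hg⟩

theorem completionAct_eq_pull (hX : IsFlow (K ≃[L] K) (BigRamseySpace L K'))
    (x : BigRamseySpace L K') {η : K ↪[L] K} {ξ : LeftCompletion (K ≃[L] K)}
    (hη : Represents η ξ) : (completionAct x ξ : BigRamseySpace L K').1 = pull x.1 η := by
  obtain ⟨l, hl, hlim, hev⟩ := hη
  refine tendsto_nhds_unique ((continuous_subtype_val.tendsto _).comp
    (tendsto_completionAct hX x hlim)) (tendsto_structure_iff.2 fun s => ?_)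
  filter_upwards [(Filter.eventually_all_finset s).2 fun a _ => hev a] with g hg
  exact restr_pull_congr x.1 hg

end OrbitClosure

/-! ### Big Ramsey degrees and the completion point -/

section Ramsey

variable {L : FirstOrder.Language} [L.IsRelational] {K : Type u} [iK : L.Structure K]
  {L' : FirstOrder.Language} [L'.IsRelational] {φ : L →ᴸ L'} {K' : L'.Structure K}

theorem pull_mem_expansions (hred : reduct φ K' = iK) {A : Type*} [iA : L.Structure A]
    (e : A ↪[L] K) : pull K' e ∈ expansions φ K' A := by
  refine ⟨?_, ⟨@Language.Embedding.mk L' A K (pull K' e) K' e.toEmbedding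
    (fun F => isEmptyElim F) (fun _ _ => Iff.rfl)⟩⟩
  refine Structure.ext ?_ ?_
  · funext n F
    exact isEmptyElim F
  · funext n R t
    have h : K'.RelMap (φ.onRelation R) (e ∘ t) = iK.RelMap R (e ∘ t) :=
      congrArg (fun z : L.Structure K => z.RelMap R (e ∘ t)) hred
    exact h.trans (propext (e.map_rel R t))

theorem IsBigRamseyStructure.range_pull (h : IsBigRamseyStructure φ K') {A : Type u}
    [L.Structure A] [Finite A] (hA : Nonempty (A ↪[L] K)) (η : K ↪[L] K) :
    (range fun f : A ↪[L] K => pull K' (η.comp f)) = expansions φ K' A :=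
  eq_of_subset_of_ncard_le (range_subset_iff.2 fun f => pull_mem_expansions h.reduct_eq (η.comp f))
    (h.witness A hA η) (h.finite_expansions A hA)

/-- The palette of pairs (expansion, color) is thinned to at most `|K'(A)|` pairs, while no
expansion can be lost; so each expansion retains a single color. The prior embedding `η₀` allows
iteration. -/
theorem IsBigRamseyStructure.exists_factor (h : IsBigRamseyStructure φ K') {A : Type u}
    [L.Structure A] [Finite A] (hA : Nonempty (A ↪[L] K)) {ι : Type*} [Finite ι]
    (γ : (A ↪[L] K) → ι) (η₀ : K ↪[L] K) :
    ∃ η₁ : K ↪[L] K, ∀ f f' : A ↪[L] K,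
      pull K' (η₀.comp (η₁.comp f)) = pull K' (η₀.comp (η₁.comp f')) →
      γ (η₀.comp (η₁.comp f)) = γ (η₀.comp (η₁.comp f')) := by
  have := (h.finite_expansions A hA).to_subtype
  let δ : (A ↪[L] K) → expansions φ K' A × ι := fun f =>
    (⟨pull K' (η₀.comp f), pull_mem_expansions h.reduct_eq (η₀.comp f)⟩, γ (η₀.comp f))
  obtain ⟨N, ⟨e⟩⟩ := Finite.exists_equiv_fin (expansions φ K' A × ι)
  let ℓ := (expansions φ K' A).ncard
  -- `N` colors suffice for the pairs; the padding by `ℓ + 1` puts the palette above the degree, as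
  -- the arrow relation requires.
  let code : expansions φ K' A × ι → Fin (N + ℓ + 1) := fun p => Fin.castLE (by omega) (e p)
  have hcode : Function.Injective code := (Fin.castLE_injective _).comp e.injective
  obtain ⟨η₁, hη₁⟩ := (h.bigRamseyDegree A hA).1 (N + ℓ + 1) (by change _ < _; omega)
    (code ∘ δ)
  refine ⟨η₁, ?_⟩
  let T : Set (expansions φ K' A × ι) := range fun f : A ↪[L] K => δ (η₁.comp f)
  have hT : T.ncard ≤ ℓ := by
    rw [← ncard_image_of_injective T hcode, ← range_comp]
    exact hη₁
  have himg : (fun p : expansions φ K' A × ι => (p.1 : L'.Structure A)) '' T =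
      expansions φ K' A := by
    refine Eq.trans ?_ (h.range_pull hA (η₀.comp η₁))
    exact (range_comp _ _).symm
  -- A set of at most `ℓ` pairs projects onto `ℓ` expansions, so the projection is injective.
  have hinj : InjOn (fun p : expansions φ K' A × ι => (p.1 : L'.Structure A)) T := by
    refine injOn_of_ncard_image_eq (le_antisymm (ncard_image_le T.toFinite) ?_) T.toFinite
    rw [himg]
    exact hT
  intro f f' hff'
  exact congrArg Prod.snd (hinj (mem_range_self f) (mem_range_self f') hff')

/-- Factoring already achieved survives precomposition by a further self-embedding, so the colorings
are handled one at a time. -/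
theorem IsBigRamseyStructure.exists_factor_family (h : IsBigRamseyStructure φ K') {J : Type*}
    (F : Finset J) (A : J → Type u) [∀ j, L.Structure (A j)] [∀ j, Finite (A j)]
    (hA : ∀ j, Nonempty (A j ↪[L] K)) (ι : J → Type*) [∀ j, Finite (ι j)]
    (γ : ∀ j, (A j ↪[L] K) → ι j) :
    ∃ η : K ↪[L] K, ∀ j ∈ F, ∀ f f' : A j ↪[L] K,
      pull K' (η.comp f) = pull K' (η.comp f') → γ j (η.comp f) = γ j (η.comp f') := by
  classical
  induction F using Finset.induction_on with
  | empty => exact ⟨Embedding.refl L K, by simp⟩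
  | insert i F _ ih =>
    obtain ⟨η₀, hη₀⟩ := ih
    obtain ⟨η₁, hη₁⟩ := h.exists_factor (hA i) (γ i) η₀
    refine ⟨η₀.comp η₁, fun j hj f f' hff' => ?_⟩
    rcases Finset.mem_insert.1 hj with rfl | hj
    · exact hη₁ f f' hff'
    · exact hη₀ j hj (η₁.comp f) (η₁.comp f') hff'

/-- The substructure of `K` on a finite set. -/
instance finsetStructure (s : Finset K) : L.Structure s := restr s iK

/-- The restriction of an embedding to a finite substructure. -/
def resEmb (s : Finset K) (η : K ↪[L] K) : s ↪[L] K where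
  toFun a := η a
  inj' _ _ h := Subtype.ext (η.injective h)
  map_fun' F := isEmptyElim F
  map_rel' R t := η.map_rel R fun i => (t i : K)

theorem nonempty_finset_embedding (s : Finset K) : Nonempty (s ↪[L] K) :=
  ⟨resEmb s (Embedding.refl L K)⟩

theorem exists_aut_resEmb (hK : L.IsUltrahomogeneous K) {s : Finset K} (e : s ↪[L] K) :
    ∃ g : K ≃[L] K, resEmb s g.toEmbedding = e := by
  classical
  let f : K → K := fun a => if ha : a ∈ s then e ⟨a, ha⟩ else a
  have hf : ∀ a (ha : a ∈ s), f a = e ⟨a, ha⟩ := fun a ha => dif_pos ha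
  obtain ⟨g, hg⟩ := exists_aut_extending hK s f
    (fun a ha b hb hab => by
      rw [hf a ha, hf b hb] at hab
      exact congrArg Subtype.val (e.injective hab))
    (fun n R t ht => by
      have : f ∘ t = e ∘ fun i => ⟨t i, ht i⟩ := funext fun i => hf _ (ht i)
      rw [this]
      exact e.map_rel R _)
  exact ⟨g, Embedding.ext fun a => (hg a a.2).trans (hf a a.2)⟩

theorem restr_mem_expansions (hred : reduct φ K' = iK) {x : L'.Structure K}
    (hx : x ∈ orbitClosure (K ≃[L] K) K') (s : Finset K) : restr s x ∈ expansions φ K' s := by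
  obtain ⟨g, hg⟩ := mem_orbitClosure_iff.1 hx s
  rw [← hg]
  exact pull_mem_expansions hred (resEmb s g.toEmbedding)

theorem IsBigRamseyStructure.exists_restr_eq (h : IsBigRamseyStructure φ K')
    (hK : L.IsUltrahomogeneous K) (η : K ↪[L] K) {x : L'.Structure K}
    (hx : x ∈ orbitClosure (K ≃[L] K) K') (s : Finset K) :
    ∃ g : K ≃[L] K, restr s (pull K' (η ∘ g)) = restr s x := by
  have hmem := restr_mem_expansions h.reduct_eq hx s
  rw [← h.range_pull (nonempty_finset_embedding s) η] at hmem
  obtain ⟨e, he⟩ := hmem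
  obtain ⟨g, rfl⟩ := exists_aut_resEmb hK e
  exact ⟨g, he⟩

theorem IsBigRamseyStructure.isFlow (h : IsBigRamseyStructure φ K') :
    IsFlow (K ≃[L] K) (BigRamseySpace L K') := by
  classical
  refine ⟨isCompact_iff_compactSpace.1 (isCompact_of_finite_restr isClosed_closure fun s => ?_),
    inferInstanceAs (T2Space (Subtype _)), ?_⟩
  · exact (h.finite_expansions s (nonempty_finset_embedding s)).subset
      (image_subset_iff.2 fun x hx => restr_mem_expansions h.reduct_eq hx s)
  · refine continuous_induced_rng.2 (continuous_iff_continuousAt.2 fun ⟨x, g⟩ => ?_)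
    refine tendsto_structure_iff.2 fun s => ?_
    have h₁ : ∀ᶠ p : BigRamseySpace L K' × (K ≃[L] K) in 𝓝 (x, g), ∀ a ∈ s, p.2 a = g a :=
      continuous_snd.tendsto (x, g) (setOf_agree_mem_nhds s g)
    have h₂ : ∀ᶠ p : BigRamseySpace L K' × (K ≃[L] K) in 𝓝 (x, g),
        restr (s.image g) p.1.1 = restr (s.image g) x.1 :=
      tendsto_structure_iff.1 ((continuous_subtype_val.comp continuous_fst).tendsto (x, g)) _
    filter_upwards [h₁, h₂] with p hp₁ hp₂
    exact (restr_pull_congr p.1.1 hp₁).trans (restr_pull_eq_of_image hp₂)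

theorem IsBigRamseyStructure.hasDenseOrbit (h : IsBigRamseyStructure φ K')
    (hK : L.IsUltrahomogeneous K) (η : K ↪[L] K) {x : BigRamseySpace L K'}
    (hx : x.1 = pull K' η) : HasDenseOrbit (K ≃[L] K) x := by
  intro p
  rw [closure_induced, ← range_comp]
  refine mem_closure_structure_iff.2 fun s => ?_
  obtain ⟨g, hg⟩ := h.exists_restr_eq hK η p.2 s
  refine ⟨_, ⟨g, rfl⟩, ?_⟩
  rw [← hg]
  change restr s (pull x.1 g) = _
  rw [hx]

theorem IsBigRamseyStructure.isCompletionPoint (h : IsBigRamseyStructure φ K')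
    (hK : L.IsUltrahomogeneous K) : IsCompletionPoint (K ≃[L] K) (basePoint L K') := by
  intro ξ
  obtain ⟨η, hη⟩ := exists_representing ξ
  exact h.hasDenseOrbit hK η (completionAct_eq_pull h.isFlow _ hη)

theorem IsBigRamseyStructure.isCompletionFlow (h : IsBigRamseyStructure φ K')
    (hK : L.IsUltrahomogeneous K) : IsCompletionFlow (K ≃[L] K) (BigRamseySpace L K') :=
  ⟨h.isFlow, _, h.isCompletionPoint hK⟩

end Ramsey

/-! ### Coalescence and universality -/

section Universal

variable {L : FirstOrder.Language} [L.IsRelational] {K : Type u} [iK : L.Structure K]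
  {L' : FirstOrder.Language} [L'.IsRelational] {φ : L →ᴸ L'} {K' : L'.Structure K}

/-- Every surjective endomorphism of the flow of a big Ramsey structure is injective. -/
theorem IsBigRamseyStructure.injective_of_surjective (h : IsBigRamseyStructure φ K')
    (hK : L.IsUltrahomogeneous K) {σ : BigRamseySpace L K' → BigRamseySpace L K'}
    (hσ : IsFlowMap (K ≃[L] K) σ) (hs : Function.Surjective σ) : Function.Injective σ := by
  have hX : IsFlow (K ≃[L] K) (BigRamseySpace L K') := h.isFlow
  have key : ∀ (s : Finset K) (x x' : BigRamseySpace L K'), restr s x.1 = restr s x'.1 →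
      restr s (σ x).1 = restr s (σ x').1 := by
    intro s
    have hval : ∀ e : s ↪[L] K,
        pull (σ (basePoint L K')).1 e ∈ expansions φ K' s := by
      intro e
      obtain ⟨g, rfl⟩ := exists_aut_resEmb hK e
      have := restr_mem_expansions h.reduct_eq (σ (op g • basePoint L K')).2 s
      rwa [hσ.map_act] at this
    have := (h.finite_expansions s (nonempty_finset_embedding s)).to_subtype
    -- Embeddings `e` of `s` are colored by `σ(K') · e`, which takes values in the finite set
    -- `K'(s)`.
    obtain ⟨η, hη⟩ := h.exists_factor (nonempty_finset_embedding s)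
      (fun e : s ↪[L] K => (⟨_, hval e⟩ : expansions φ K' s)) (Embedding.refl L K)
    obtain ⟨ξ, hξ⟩ := exists_represented hK η
    let z : BigRamseySpace L K' := completionAct (basePoint L K') ξ
    have hz : z.1 = pull K' η := completionAct_eq_pull hX _ hξ
    have hσz : (σ z).1 = pull (σ (basePoint L K')).1 η := by
      rw [hσ.map_completionAct hX hX]
      exact completionAct_eq_pull hX _ hξ
    have hcolor : ∀ g g' : K ≃[L] K,
        restr s (op g • z).1 = restr s (op g' • z).1 →
        restr s (σ (op g • z)).1 = restr s (σ (op g' • z)).1 := by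
      intro g g' hgg'
      have h₁ : ∀ k : K ≃[L] K, (op k • z).1 = pull K' (η ∘ k) := fun k => by
        change pull z.1 k = _
        rw [hz]
        rfl
      have h₂ : ∀ k : K ≃[L] K,
          (σ (op k • z)).1 = pull (σ (basePoint L K')).1 (η ∘ k) := fun k => by
        rw [hσ.map_act]
        change pull (σ z).1 k = _
        rw [hσz]
        rfl
      rw [h₁, h₁] at hgg'
      rw [h₂, h₂]
      exact congrArg Subtype.val
        (hη (resEmb s g.toEmbedding) (resEmb s g'.toEmbedding) hgg')
    have happ : ∀ x : BigRamseySpace L K', ∃ g : K ≃[L] K,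
        restr s (op g • z).1 = restr s x.1 ∧ restr s (σ (op g • z)).1 = restr s (σ x).1 := by
      intro x
      have h₁ : ∀ᶠ x' in 𝓝 x, restr s x'.1 = restr s x.1 :=
        tendsto_structure_iff.1 (continuous_subtype_val.tendsto x) s
      have h₂ : ∀ᶠ x' in 𝓝 x, restr s (σ x').1 = restr s (σ x).1 :=
        tendsto_structure_iff.1 ((continuous_subtype_val.comp hσ.continuous).tendsto x) s
      obtain ⟨_, ⟨g, rfl⟩, hg⟩ :=
        (h.hasDenseOrbit hK η hz).inter_nhds_nonempty (h₁.and h₂)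
      exact ⟨g, hg⟩
    intro x x' hxx'
    obtain ⟨g, hg, hgσ⟩ := happ x
    obtain ⟨g', hg', hgσ'⟩ := happ x'
    rw [← hgσ, ← hgσ']
    exact hcolor g g' (hg.trans (hxx'.trans hg'.symm))
  intro x x' hxx'
  refine Subtype.ext (structure_ext_restr fun s => ?_)
  let T : Set (L'.Structure s) := range fun x : BigRamseySpace L K' => restr s x.1
  have hT : T.Finite := (h.finite_expansions s (nonempty_finset_embedding s)).subset
    (range_subset_iff.2 fun x => restr_mem_expansions h.reduct_eq x.2 s)
  have := hT.to_subtype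
  let r : BigRamseySpace L K' → T := fun x => ⟨restr s x.1, mem_range_self x⟩
  have hr : Function.Surjective r := fun ⟨_, x, hx⟩ => ⟨x, Subtype.ext hx⟩
  -- By `key`, σ descends to the finite set of restrictions to `s`, where surjective implies
  -- injective.
  let τ : T → T := fun t => r (σ (Function.surjInv hr t))
  have hτ : ∀ x, τ (r x) = r (σ x) := fun x => Subtype.ext
    (key s _ _ (congrArg Subtype.val (Function.surjInv_eq hr (r x))))
  have hτs : Function.Surjective τ := by
    intro t
    obtain ⟨y, rfl⟩ := hr t
    obtain ⟨x, rfl⟩ := hs y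
    exact ⟨r x, hτ x⟩
  have hτi : Function.Injective τ := Finite.injective_iff_surjective.2 hτs
  have : r x = r x' := hτi (by rw [hτ, hτ, hxx'])
  exact congrArg Subtype.val this

/-- Along the orbit of a point of a flow, translates are determined up to a given entourage by
finitely many colors of embeddings of a finite substructure. -/
theorem exists_coloring (hK : L.IsUltrahomogeneous K) {Y : Type*} [UniformSpace Y]
    [MulAction (K ≃[L] K)ᵐᵒᵖ Y] (hY : IsFlow (K ≃[L] K) Y) (y : Y) {W : Set (Y × Y)}
    (hW : W ∈ uniformity Y) :
    ∃ (s : Finset K) (t : Finset Y) (γ : (s ↪[L] K) → t), ∀ g h : K ≃[L] K,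
      γ (resEmb s g.toEmbedding) = γ (resEmb s h.toEmbedding) → (op g • y, op h • y) ∈ W := by
  have := hY.compact
  obtain ⟨V₁, hV₁, hV₁s, hV₁W⟩ := comp_symm_mem_uniformity_sets hW
  obtain ⟨V, hV, hVs, hVV₁⟩ := comp_symm_mem_uniformity_sets hV₁
  have hcont : Continuous (Function.uncurry fun (g : K ≃[L] K) (y : Y) => op g • y) :=
    hY.continuous_act.comp (continuous_snd.prodMk continuous_fst)
  obtain ⟨U, hU, hUV⟩ := isCompact_univ.mem_uniformity_of_prod (s := univ)
    (q := (1 : K ≃[L] K)) (k := (univ : Set Y)) hcont.continuousOn (mem_univ _)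
    (symm_le_uniformity hV)
  rw [nhdsWithin_univ] at hU
  obtain ⟨s, hs⟩ := exists_agree_subset hU
  -- The colors form a finite `V`-net; an embedding of `s` is colored by a net point near `y · k`,
  -- for a chosen automorphism `k` extending it.
  obtain ⟨t, ht⟩ : ∃ t : Finset Y, ∀ q : Y, ∃ c ∈ t, (q, c) ∈ V := by
    obtain ⟨t, htf, ht⟩ := (isCompact_univ (X := Y)).totallyBounded V hV
    refine ⟨htf.toFinset, fun q => ?_⟩
    obtain ⟨c, hc, hqc⟩ := mem_iUnion₂.1 (ht (mem_univ q))
    exact ⟨c, by simpa using hc, hqc⟩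
  choose c hct hc using ht
  choose ĝ hĝ using fun e : s ↪[L] K => exists_aut_resEmb hK e
  refine ⟨s, t, fun e => ⟨c (op (ĝ e) • y), hct _⟩, fun g h hgh => ?_⟩
  have hstep : ∀ g : K ≃[L] K,
      (op g • y, c (op (ĝ (resEmb s g.toEmbedding)) • y)) ∈ V₁ := by
    intro g
    set k := ĝ (resEmb s g.toEmbedding)
    have hkg : ∀ a ∈ s, k a = g a := fun a ha =>
      DFunLike.congr_fun (hĝ (resEmb s g.toEmbedding)) (⟨a, ha⟩ : s)
    -- Since `k` and `g` agree on `s`, `k⁻¹ * g` fixes `s` pointwise, and so moves every point of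
    -- `Y` only within `V`.
    have hmem : k⁻¹ * g ∈ U := hs fun a ha => by
      change k.symm (g a) = a
      rw [← hkg a ha, k.symm_apply_apply]
    have h₁ : (op k • y, op g • y) ∈ V := by
      have := hUV _ hmem (op k • y) (mem_univ _)
      simpa [smul_smul, ← op_mul] using this
    exact hVV₁ ⟨_, hVs.symm _ _ h₁, hc _⟩
  refine hV₁W ⟨_, hstep g, hV₁s.symm _ _ ?_⟩
  have hc' : c (op (ĝ (resEmb s g.toEmbedding)) • y) = c (op (ĝ (resEmb s h.toEmbedding)) • y) :=
    congrArg Subtype.val hgh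
  rw [hc']
  exact hstep h

theorem IsBigRamseyStructure.exists_flowMap (h : IsBigRamseyStructure φ K')
    (hK : L.IsUltrahomogeneous K) {Y : Type*} [TopologicalSpace Y]
    [MulAction (K ≃[L] K)ᵐᵒᵖ Y] (hY : IsCompletionFlow (K ≃[L] K) Y) :
    ∃ f : BigRamseySpace L K' → Y, IsFlowMap (K ≃[L] K) f ∧ Function.Surjective f := by
  classical
  have := hY.isFlow.compact
  have := hY.isFlow.hausdorff
  let : UniformSpace Y := uniformSpaceOfCompactR1
  obtain ⟨y, hy⟩ := hY.exists_point
  have hX : IsFlow (K ≃[L] K) (BigRamseySpace L K') := h.isFlow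
  let E := {W : Set (Y × Y) // W ∈ uniformity Y ∧ IsClosed W}
  choose s t γ hγ using fun W : E => exists_coloring hK hY.isFlow y W.2.1
  -- An index pairs a closed entourage with a finite set: `s j.1` makes restrictions determine
  -- colors, and `j.2` makes them fine enough to generate the topology of `X_{K'}`.
  refine exists_surjective_flowMap hX hY.isFlow (J := E × Finset K)
    (τ := fun j => L'.Structure ↥(s j.1 ∪ j.2)) (fun j x => restr (s j.1 ∪ j.2) x.1)
    (fun j => ?_) (fun p N hN => ?_) (fun j => j.1.1) (fun j => j.1.2.2) (fun j => j.1.2.1)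
    (fun V hV => ?_) (fun F => ?_)
  · refine (IsLocallyConstant.iff_eventually_eq _).2 fun x => ?_
    exact tendsto_structure_iff.1 (continuous_subtype_val.tendsto x) _
  · obtain ⟨U, hU, hUN⟩ := (mem_nhds_induced _ p N).1 hN
    obtain ⟨U', hU'U, hU', hpU'⟩ := mem_nhds_iff.1 hU
    obtain ⟨q, hq⟩ := exists_restr_subset hU' hpU'
    exact ⟨(⟨univ, univ_mem, isClosed_univ⟩, q), fun p' hp' =>
      hUN (hU'U (hq _ (restr_mono Finset.subset_union_right hp')))⟩
  · obtain ⟨W, ⟨hW, hWc⟩, hWV⟩ := uniformity_hasBasis_closed.mem_iff.1 hV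
    exact ⟨(⟨W, hW, hWc⟩, ∅), hWV⟩
  · obtain ⟨η, hη⟩ := h.exists_factor_family (F.image Prod.fst) (fun W : E => s W)
      (fun W => nonempty_finset_embedding (s W)) (fun W => t W) γ
    obtain ⟨ξ, hξ⟩ := exists_represented hK η
    have hz : (completionAct (basePoint L K') ξ).1 = pull K' η := completionAct_eq_pull hX _ hξ
    refine ⟨completionAct (basePoint L K') ξ, completionAct y ξ, h.hasDenseOrbit hK η hz, hy ξ,
      fun j hj g g' hgg' => ?_⟩
    have hpull : ∀ k : K ≃[L] K,
        (op k • completionAct (basePoint L K') ξ).1 = pull K' (η ∘ k) := fun k => by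
      change pull (completionAct (basePoint L K') ξ).1 k = _
      rw [hz]
      rfl
    have hres := restr_mono (s := s j.1) Finset.subset_union_left hgg'
    rw [hpull, hpull] at hres
    have hcol := hη j.1 (Finset.mem_image_of_mem _ hj) (resEmb (s j.1) g.toEmbedding)
      (resEmb (s j.1) g'.toEmbedding) hres
    -- The coloring controls translates of `y`, not of `y · η`. Approximate η by automorphisms `k`
    -- and pass to the limit, using that the entourage is closed.
    obtain ⟨l, hl, hev, hlim⟩ := hξ.act_mul hY.isFlow y
    refine j.1.2.2.mem_of_tendsto ((hlim g).prodMk_nhds (hlim g')) ?_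
    have hagree : ∀ m : K ≃[L] K, ∀ᶠ k in l,
        resEmb (s j.1) (k * m).toEmbedding = η.comp (resEmb (s j.1) m.toEmbedding) := by
      intro m
      filter_upwards [(Filter.eventually_all_finset (s j.1)).2 fun a _ => hev (m a)] with k hk
      exact Embedding.ext fun a => hk a a.2
    filter_upwards [hagree g, hagree g'] with k hk hk'
    refine hγ j.1 _ _ ?_
    rw [hk, hk', hcol]

theorem IsBigRamseyStructure.isUniversalCompletionFlow (h : IsBigRamseyStructure φ K')
    (hK : L.IsUltrahomogeneous K) :
    IsUniversalCompletionFlow.{v} (K ≃[L] K) (BigRamseySpace L K') :=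
  ⟨h.isCompletionFlow hK, fun _ _ _ hY => h.exists_flowMap hK hY⟩

theorem IsBigRamseyStructure.flowIso_of_isUniversal [Small.{v} (K ≃[L] K)]
    (h : IsBigRamseyStructure φ K') (hK : L.IsUltrahomogeneous K) {X : Type*}
    [TopologicalSpace X] [MulAction (K ≃[L] K)ᵐᵒᵖ X]
    (hX : IsUniversalCompletionFlow.{v} (K ≃[L] K) X) :
    FlowIso (K ≃[L] K) (BigRamseySpace L K') X := by
  obtain ⟨f, hf, hfs⟩ := h.exists_flowMap hK hX.isCompletionFlow
  obtain ⟨f', hf', hfs'⟩ := hX.exists_map' (h.isCompletionFlow hK)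
  have hinj := h.injective_of_surjective hK (hf'.comp hf) (hfs'.comp hfs)
  exact flowIso_of_bijective h.isFlow hX.isCompletionFlow.isFlow hf ⟨hinj.of_comp, hfs⟩

end Universal

/-- A countable `K` has a copy in every universe, hence so does a set of self-maps of `K`. -/
theorem small_aut {L : FirstOrder.Language} {K : Type u} [L.Structure K] [Countable K] :
    Small.{v} (K ≃[L] K) :=
  small_of_injective (f := fun (g : K ≃[L] K) (x : K) => g x) DFunLike.coe_injective

end BigRamsey

theorem mainTheorem1
    (L : FirstOrder.Language.{c, d}) [L.IsRelational] (K : Type u) [L.Structure K]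
    (hK : BigRamsey.IsFraisseStructure L K)
    (hBR : BigRamsey.AdmitsBigRamseyStructure.{u, a, b} L K) :
    -- the orbit closure of any big Ramsey structure is a universal completion flow
    (∀ (L' : FirstOrder.Language.{a, b}) [L'.IsRelational] (φ : L →ᴸ L') (K' : L'.Structure K),
      BigRamsey.IsBigRamseyStructure φ K' →
      BigRamsey.IsUniversalCompletionFlow.{v} (K ≃[L] K) (BigRamsey.BigRamseySpace L K')) ∧
    -- any big Ramsey flow is a universal completion flow
    (∀ (Z : Type w₁) [TopologicalSpace Z] [MulAction (K ≃[L] K)ᵐᵒᵖ Z],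
      BigRamsey.IsBigRamseyFlow.{u, a, b} L K Z →
      BigRamsey.IsUniversalCompletionFlow.{v} (K ≃[L] K) Z) ∧
    -- any two universal completion flows are isomorphic
    (∀ (X₁ : Type w₁) [TopologicalSpace X₁] [MulAction (K ≃[L] K)ᵐᵒᵖ X₁]
      (X₂ : Type w₂) [TopologicalSpace X₂] [MulAction (K ≃[L] K)ᵐᵒᵖ X₂],
      BigRamsey.IsUniversalCompletionFlow.{v} (K ≃[L] K) X₁ →
      BigRamsey.IsUniversalCompletionFlow.{v} (K ≃[L] K) X₂ →
      BigRamsey.FlowIso (K ≃[L] K) X₁ X₂) := by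
  have := hK.countable
  have : Small.{v} (K ≃[L] K) := BigRamsey.small_aut
  refine ⟨fun L' _ φ K' h => h.isUniversalCompletionFlow hK.homogeneous, ?_, ?_⟩
  · rintro Z _ _ ⟨z, L', _, φ, K', h, e, he, -⟩
    exact (h.isUniversalCompletionFlow hK.homogeneous).of_flowIso
      (BigRamsey.FlowIso.symm ⟨e, he⟩)
  · intro X₁ _ _ X₂ _ _ h₁ h₂
    obtain ⟨L', _, φ, K', h⟩ := hBR
    exact (h.flowIso_of_isUniversal hK.homogeneous h₁).symm.trans
      (h.flowIso_of_isUniversal hK.homogeneous h₂)
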